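/- Terms are built over a signature $\mathcal F$ and an infinite set of variables $\mathcal V$. Equational systems (ESs) and term rewrite systems (TRSs) are sets of pairs of terms. For an ES $E$ let $E^{\pm}=E\cup\{t\approx s\mid s\approx t\in E\}$. A renaming is a permutation of $\mathcal V$, and a variant of a pair of terms is its image under a renaming. A reduction order is a well-founded strict order $>$ on terms closed under contexts and substitutions. It is ground-total if any two distinct ground terms are comparable, and a constant $c$ is minimal if $t=c$ or $t>c$ for every ground term $t$. For a set of rules $R$ and a set of equations $E$, the equations being usable in both directions, let $(R\cup E)^>$ be the TRS of all $s\sigma\to t\sigma$ with $(s,t)\in R\cup E^{\pm}$, $\sigma$ a substitution and $s\sigma>t\sigma$. A TRS is ground complete if it is terminating and confluent on ground terms. For a TRS $S$, $\to_S$ is its rewrite relation, $s\downarrow_S t$ means that $s$ and $t$ rewrite by $S$ to a common term, and $\leftrightarrow^*_S$ is the conversion relation (also for ESs). The inference system $\mathsf{oKB}$ acts on pairs $(E,R)$ of equations and rules by the following steps, where $\pi$ is any renaming, $S=(R\cup E)^>$, and $\uplus$ is disjoint union. \begin{itemize} \item deduce: $(E,R)\vdash(E\cup\{s\pi\approx t\pi\},R)$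 if $u\to s$ and $u\to t$ for some term $u$, where $\to$ is the rewrite relation of $R\cup E^{\pm}$; \item orient: $(E\uplus\{s\approx t\},R)\vdash(E,R\cup\{s\pi\to t\pi\})$ if $s>t$, and $(E\uplus\{s\approx t\},R)\vdash(E,R\cup\{t\pi\to s\pi\})$ if $t>s$; \item delete: $(E\uplus\{s\approx s\},R)\vdash(E,R)$; \item compose: $(E,R\uplus\{s\to t\})\vdash(E,R\cup\{s\pi\to u\pi\})$ if $t\to_S u$; \item simplify: $(E\uplus\{s\approx t\},R)\vdash(E\cup\{u\pi\approx t\pi\},R)$ if $s\to_S u$, and $(E\uplus\{s\approx t\},R)\vdash(E\cup\{s\pi\approx u\pi\},R)$ if $t\to_S u$; \item collapse: $(E,R\uplus\{t\to s\})\vdash(E\cup\{u\pi\approx s\pi\},R)$ if $t\to_S u$. \end{itemize} An extended critical pair of an ES $E$ is a pair $\ell_2[r_1]_p\mu\approx r_2\mu$, where $\ell_1\approx r_1$ and $\ell_2\approx r_2$ are variable-disjoint variants of equations in $E^{\pm}$, $p$ is a non-variable position of $\ell_2$, $\mu$ is a most general unifier of $\ell_1$ and $\ell_2|_p$, and neither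 $r_1\mu>\ell_1\mu$ nor $r_2\mu>\ell_2\mu$ holds. **Theorem.** Let $>$ be a ground-total reduction order with a minimal constant $c$, and let $(E_0,\varnothing)\vdash^*(E,R)$ be a finite run of $\mathsf{oKB}$ using $>$. Suppose that for every extended critical pair $s\approx t$ of $E^{\pm}\cup R$ either $s\downarrow_{(R\cup E)^>}t$, or $s=s'\sigma$ and $t=t'\sigma$ for some $s'\approx t'\in E^{\pm}$ and some substitution $\sigma$. Then ${\leftrightarrow^*_{E_0}}={\leftrightarrow^*_{R\cup E}}$, and $(R\cup E)^>$ is ground complete. Moreover, $(R\cup E)^>$ is a presentation of $E_0$ on ground terms: for all ground terms $s,t$, $s\leftrightarrow^*_{E_0}t$ if and only if $s\leftrightarrow^*_{(R\cup E)^>}t$. -/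

import Mathlib

/-!
First-order terms over a signature are Mathlib's terms `L.Term V`, where the function symbols of the
language `L` form the signature (relation symbols play no role) and `V` is the set of variables.
Equational systems and term rewrite systems are sets of pairs of terms.
-/

universe u v w

namespace OrdCompletion

open FirstOrder FirstOrder.Language

/-- A pair of terms, read as an equation or as a rewrite rule. -/
abbrev TermPair (L : FirstOrder.Language.{u, v}) (V : Type w) := L.Term V × L.Term V

/-- A set of equations or of rewrite rules. -/
abbrev System (L : FirstOrder.Language.{u, v}) (V : Type w) := Set (TermPair L V)

section

variable {L : FirstOrder.Language.{u, v}} {V : Type w}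

open Classical in
/-- The variables that occur in a term. -/
noncomputable def vars (t : L.Term V) : Finset V := t.varFinset

/-- Ground terms: terms without variables. -/
def Ground (t : L.Term V) : Prop := vars t = ∅

/-- `t` is a variable. -/
def IsVar (t : L.Term V) : Prop := ∃ x : V, t = Term.var x

variable (L V) in
/-- Terms with one hole. In `arg f i C ts` the `i`-th argument of `f` is the context `C` and the
other arguments are given by `ts`; the value `ts i` is irrelevant. A context together with its
filling is the same thing as a term together with one of its positions. -/
inductive Ctx : Type (max u w)
  | hole : Ctx
  | arg {n : ℕ} (f : L.Functions n) (i : Fin n) (C : Ctx) (ts : Fin n → L.Term V) : Ctx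

/-- `C.fill t` is the term `C[t]`. -/
def Ctx.fill : Ctx L V → L.Term V → L.Term V
  | .hole, t => t
  | .arg f i C ts, t => Term.func f (Function.update ts i (C.fill t))

/-- The rewrite relation of `R`: `C[lσ] → C[rσ]` for a rule `l → r` of `R`. -/
def Step (R : System L V) (s t : L.Term V) : Prop :=
  ∃ l r : L.Term V, (l, r) ∈ R ∧ ∃ (C : Ctx L V) (σ : V → L.Term V),
    s = C.fill (l.subst σ) ∧ t = C.fill (r.subst σ)

/-- The conversion relation `↔*` of `R`. -/
def Conv (R : System L V) : L.Term V → L.Term V → Prop := Relation.EqvGen (Step R)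

/-- `s` and `t` rewrite to a common term. -/
def Joinable (R : System L V) (s t : L.Term V) : Prop :=
  ∃ w : L.Term V, Relation.ReflTransGen (Step R) s w ∧ Relation.ReflTransGen (Step R) t w

/-- Termination: no infinite rewrite sequence. -/
def Terminating (R : System L V) : Prop := WellFounded (fun t s : L.Term V => Step R s t)

/-- Confluence on ground terms: any two terms reachable from a ground term are joinable. -/
def GroundConfluent (R : System L V) : Prop :=
  ∀ s t u : L.Term V, Ground s →
    Relation.ReflTransGen (Step R) s t → Relation.ReflTransGen (Step R) s u → Joinable R t u

/-- Ground completeness. -/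
def GroundComplete (R : System L V) : Prop := Terminating R ∧ GroundConfluent R

/-- `R` presents `E` on ground terms. -/
def GroundPresentation (R E : System L V) : Prop :=
  ∀ s t : L.Term V, Ground s → Ground t → (Conv E s t ↔ Conv R s t)

/-- Symmetric closure of a set of equations. -/
def symCl (E : System L V) : System L V := E ∪ {e | (e.2, e.1) ∈ E}

/-- Reduction orders: well-founded strict orders on terms that are closed under contexts and
substitutions (irreflexivity follows from well-foundedness). -/
structure IsReductionOrder (gt : L.Term V → L.Term V → Prop) : Prop where
  trans : ∀ s t u, gt s t → gt t u → gt s u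
  wf : WellFounded (fun t s => gt s t)
  ctx : ∀ (C : Ctx L V) (s t : L.Term V), gt s t → gt (C.fill s) (C.fill t)
  subst : ∀ (σ : V → L.Term V) (s t : L.Term V), gt s t → gt (s.subst σ) (t.subst σ)

/-- Totality on ground terms. -/
def GroundTotal (gt : L.Term V → L.Term V → Prop) : Prop :=
  ∀ s t : L.Term V, Ground s → Ground t → s = t ∨ gt s t ∨ gt t s

/-- The constant `c` is minimal among the ground terms. -/
def IsMinimalConstant (gt : L.Term V → L.Term V → Prop) (c : L.Constants) : Prop :=
  ∀ t : L.Term V, Ground t → t = c.term ∨ gt t c.term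

/-- The decreasing instances `sσ → tσ`, `sσ > tσ`, of the pairs `s ≈ t` in `E`. -/
def ordInst (gt : L.Term V → L.Term V → Prop) (E : System L V) : System L V :=
  {e | ∃ s t : L.Term V, (s, t) ∈ E ∧ ∃ σ : V → L.Term V,
    gt (s.subst σ) (t.subst σ) ∧ e = (s.subst σ, t.subst σ)}

/-- Ordered rewriting with rules `R` and equations `E`: the decreasing instances of the rules and
of the equations, where equations are used in both directions. -/
def ordSys (gt : L.Term V → L.Term V → Prop) (R E : System L V) : System L V :=
  ordInst gt (R ∪ symCl E)

/-- The variant of a pair of terms under a variable permutation. -/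
def rename (π : Equiv.Perm V) (e : TermPair L V) : TermPair L V :=
  (e.1.relabel π, e.2.relabel π)

/-- `μ` is a most general unifier of `s` and `t`. -/
def IsMGU (μ : V → L.Term V) (s t : L.Term V) : Prop :=
  s.subst μ = t.subst μ ∧
    ∀ τ : V → L.Term V, s.subst τ = t.subst τ →
      ∃ δ : V → L.Term V, ∀ x, τ x = (μ x).subst δ

/-- The extended critical pairs of `E`: `l₁ ≈ r₁` and `l₂ ≈ r₂` are variable-disjoint variants of
equations in the symmetric closure of `E`, the term `u` is the non-variable subterm of `l₂ = C[u]`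
at the position of the hole of `C`, `μ` is a most general unifier of `l₁` and `u`, and neither
`r₁μ > l₁μ` nor `r₂μ > l₂μ`. The pair is `C[r₁]μ ≈ r₂μ`. -/
def ECP (gt : L.Term V → L.Term V → Prop) (E : System L V) : System L V :=
  {e | ∃ l₁ r₁ l₂ r₂ : L.Term V,
    (∃ e₁ ∈ symCl E, ∃ π : Equiv.Perm V, (l₁, r₁) = rename π e₁) ∧
    (∃ e₂ ∈ symCl E, ∃ π : Equiv.Perm V, (l₂, r₂) = rename π e₂) ∧
    (∀ x : V, (x ∈ vars l₁ ∨ x ∈ vars r₁) → ¬ (x ∈ vars l₂ ∨ x ∈ vars r₂)) ∧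
    ∃ (C : Ctx L V) (u : L.Term V) (μ : V → L.Term V),
      l₂ = C.fill u ∧ ¬ IsVar u ∧ IsMGU μ l₁ u ∧
      ¬ gt (r₁.subst μ) (l₁.subst μ) ∧ ¬ gt (r₂.subst μ) (l₂.subst μ) ∧
      e = ((C.fill r₁).subst μ, r₂.subst μ)}

/-- `s ≈ t` is an instance of an equation in `E`. -/
def IsInstance (E : System L V) (s t : L.Term V) : Prop :=
  ∃ s' t' : L.Term V, (s', t') ∈ E ∧ ∃ σ : V → L.Term V, s = s'.subst σ ∧ t = t'.subst σ

/-- One inference step of ordered completion on states `(E, R)`. The disjointness of a union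
`E ⊎ {e}` is the hypothesis `e ∉ E`; side conditions refer to the remaining `E` and `R`. -/
inductive OKB (gt : L.Term V → L.Term V → Prop) :
    System L V × System L V → System L V × System L V → Prop
  | deduce (E R : System L V) (s t u : L.Term V) (π : Equiv.Perm V)
      (hs : Step (R ∪ symCl E) u s) (ht : Step (R ∪ symCl E) u t) :
      OKB gt (E, R) (E ∪ {rename π (s, t)}, R)
  | orientLR (E R : System L V) (s t : L.Term V) (π : Equiv.Perm V)
      (hd : (s, t) ∉ E) (h : gt s t) :
      OKB gt (E ∪ {(s, t)}, R) (E, R ∪ {rename π (s, t)})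
  | orientRL (E R : System L V) (s t : L.Term V) (π : Equiv.Perm V)
      (hd : (s, t) ∉ E) (h : gt t s) :
      OKB gt (E ∪ {(s, t)}, R) (E, R ∪ {rename π (t, s)})
  | delete (E R : System L V) (s : L.Term V) (hd : (s, s) ∉ E) :
      OKB gt (E ∪ {(s, s)}, R) (E, R)
  | compose (E R : System L V) (s t u : L.Term V) (π : Equiv.Perm V)
      (hd : (s, t) ∉ R) (h : Step (ordSys gt R E) t u) :
      OKB gt (E, R ∪ {(s, t)}) (E, R ∪ {rename π (s, u)})
  | simplifyL (E R : System L V) (s t u : L.Term V) (π : Equiv.Perm V)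
      (hd : (s, t) ∉ E) (h : Step (ordSys gt R E) s u) :
      OKB gt (E ∪ {(s, t)}, R) (E ∪ {rename π (u, t)}, R)
  | simplifyR (E R : System L V) (s t u : L.Term V) (π : Equiv.Perm V)
      (hd : (s, t) ∉ E) (h : Step (ordSys gt R E) t u) :
      OKB gt (E ∪ {(s, t)}, R) (E ∪ {rename π (s, u)}, R)
  | collapse (E R : System L V) (t s u : L.Term V) (π : Equiv.Perm V)
      (hd : (t, s) ∉ R) (h : Step (ordSys gt R E) t u) :
      OKB gt (E, R ∪ {(t, s)}) (E ∪ {rename π (u, s)}, R)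

/-- Finite sequences of inference steps. -/
def Run (gt : L.Term V → L.Term V → Prop) :
    System L V × System L V → System L V × System L V → Prop :=
  Relation.ReflTransGen (OKB gt)

end

end OrdCompletion

/-!
An inference step of ordered completion does not change the conversion relation
(`OKB.conv_eq`), because every pair it adds or removes is convertible by the remaining pairs, and it
keeps all rules of `R` decreasing (`OKB.rules_gt`). Termination of the ordered rewrite system is
immediate, since its steps are contained in the reduction order.

The ground part rests on `joinable_of_ground`: two ground instances `lσ`, `rσ` of the same pair of
`R ∪ E` are equal or related by a single ordered rewrite step, since the order is total on ground
terms. Ground terms rewrite to ground terms only (`ground_of_gt`): a decreasing instance cannot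
introduce a variable, for otherwise substituting the left-hand side for it would give an infinite
descent `s > C[s] > C[C[s]] > ⋯`.

By Newman's lemma it remains to join local peaks of ground terms. Peaks at parallel positions
commute. In a nested peak the inner redex lies either inside the substitution part of the outer one
or at a non-variable position of its left-hand side (`fill_eq_subst`). In the first case the reducts
rewrite to ground instances of the outer pair, which are joinable as above. In the second case the
peak is an instance of an extended critical pair (`exists_ECP_of_overlap`), for which a renaming
apart and a most general unifier are needed; the hypothesis on critical pairs joins it, either
directly or because it is a ground instance of an equation.

For the presentation of `E₀`, all variables in a conversion between ground terms are replaced by a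
constant. Then each of its steps connects ground instances of a pair, which are joinable.
-/

namespace OrdCompletion

open FirstOrder FirstOrder.Language Relation

variable {L : FirstOrder.Language.{u, v}} {V : Type w}

/-! ### Terms, variables and substitutions -/

theorem mem_vars_var {x y : V} : x ∈ vars (Term.var y : L.Term V) ↔ x = y := by
  simp [vars]

theorem mem_vars_func {x : V} {n : ℕ} {f : L.Functions n} {ts : Fin n → L.Term V} :
    x ∈ vars (Term.func f ts) ↔ ∃ i, x ∈ vars (ts i) := by
  simp [vars]

theorem ground_iff {t : L.Term V} : Ground t ↔ ∀ x, x ∉ vars t :=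
  Finset.eq_empty_iff_forall_notMem

theorem ground_func {n : ℕ} {f : L.Functions n} {ts : Fin n → L.Term V} :
    Ground (Term.func f ts) ↔ ∀ i, Ground (ts i) := by
  simp only [ground_iff, mem_vars_func, not_exists]
  exact forall_comm

theorem ground_constant (c : L.Constants) : Ground (c.term : L.Term V) :=
  ground_func.2 fun i => i.elim0

theorem subst_congr {t : L.Term V} {σ τ : V → L.Term V} (h : ∀ x ∈ vars t, σ x = τ x) :
    t.subst σ = t.subst τ := by
  induction t with
  | var x => exact h x (mem_vars_var.2 rfl)
  | func f ts ih =>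
    simp only [Term.subst]
    congr 1
    funext i
    exact ih i fun x hx => h x (mem_vars_func.2 ⟨i, hx⟩)

theorem subst_var (t : L.Term V) : t.subst Term.var = t := by
  induction t with
  | var x => rfl
  | func f ts ih => simp [Term.subst, ih]

theorem subst_subst (t : L.Term V) (σ τ : V → L.Term V) :
    (t.subst σ).subst τ = t.subst fun x => (σ x).subst τ := by
  induction t with
  | var x => rfl
  | func f ts ih => simp [Term.subst, ih]

theorem subst_relabel (t : L.Term V) (g : V → V) (σ : V → L.Term V) :
    (t.relabel g).subst σ = t.subst fun x => σ (g x) := by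
  induction t with
  | var x => rfl
  | func f ts ih => simp [Term.subst, ih]

theorem relabel_eq_subst (t : L.Term V) (g : V → V) :
    t.relabel g = t.subst fun x => Term.var (g x) := by
  rw [← subst_relabel, subst_var]

theorem mem_vars_subst {t : L.Term V} {σ : V → L.Term V} {x : V} :
    x ∈ vars (t.subst σ) ↔ ∃ y ∈ vars t, x ∈ vars (σ y) := by
  induction t with
  | var y => simp [Term.subst, mem_vars_var]
  | func f ts ih =>
    simp only [Term.subst, mem_vars_func, ih]
    constructor
    · rintro ⟨i, y, hy, hx⟩
      exact ⟨y, ⟨i, hy⟩, hx⟩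
    · rintro ⟨y, ⟨i, hy⟩, hx⟩
      exact ⟨i, y, hy, hx⟩

theorem mem_vars_relabel {t : L.Term V} {g : V → V} {x : V} :
    x ∈ vars (t.relabel g) ↔ ∃ y ∈ vars t, x = g y := by
  simp [relabel_eq_subst, mem_vars_subst, mem_vars_var]

theorem Ground.subst_eq {t : L.Term V} (ht : Ground t) (σ : V → L.Term V) : t.subst σ = t := by
  rw [subst_congr (τ := Term.var) fun x hx => absurd hx (ground_iff.1 ht x), subst_var]

theorem ground_subst {t : L.Term V} {σ : V → L.Term V} (h : ∀ x ∈ vars t, Ground (σ x)) :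
    Ground (t.subst σ) := by
  rw [ground_iff]
  intro x hx
  obtain ⟨y, hy, hxy⟩ := mem_vars_subst.1 hx
  exact ground_iff.1 (h y hy) x hxy

/-! ### Contexts -/

/-- Application of a substitution to a context. -/
def Ctx.subst : Ctx L V → (V → L.Term V) → Ctx L V
  | .hole, _ => .hole
  | .arg f i C ts, σ => .arg f i (C.subst σ) fun j => (ts j).subst σ

theorem Ctx.fill_subst (C : Ctx L V) (t : L.Term V) (σ : V → L.Term V) :
    (C.fill t).subst σ = (C.subst σ).fill (t.subst σ) := by
  induction C with
  | hole => rfl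
  | arg f i C ts ih =>
    simp only [Ctx.fill, Ctx.subst, Term.subst]
    congr 1
    funext j
    by_cases h : j = i
    · subst h; simp [ih]
    · simp [h]

/-- Only variables of `C[u]` matter; the irrelevant argument stored at the hole is not among
them. -/
theorem Ctx.subst_fill_congr {C : Ctx L V} {u : L.Term V} {σ τ : V → L.Term V}
    (h : ∀ x ∈ vars (C.fill u), σ x = τ x) (v : L.Term V) :
    (C.subst σ).fill v = (C.subst τ).fill v := by
  induction C with
  | hole => rfl
  | arg f i C ts ih =>
    simp only [Ctx.fill, Ctx.subst] at h ⊢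
    rw [ih fun x hx => h x (mem_vars_func.2 ⟨i, by simpa using hx⟩)]
    congr 1
    funext j
    by_cases hj : j = i
    · subst hj; simp
    · simp only [Function.update_of_ne hj]
      exact subst_congr fun x hx => h x (mem_vars_func.2 ⟨j, by simpa [hj] using hx⟩)

theorem Ctx.mem_vars_fill (C : Ctx L V) {t : L.Term V} {x : V} (hx : x ∈ vars t) :
    x ∈ vars (C.fill t) := by
  induction C with
  | hole => exact hx
  | arg f i C ts ih => exact mem_vars_func.2 ⟨i, by simpa using ih⟩

theorem exists_ctx_of_mem_vars {t : L.Term V} {x : V} (hx : x ∈ vars t) :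
    ∃ C : Ctx L V, t = C.fill (Term.var x) := by
  induction t with
  | var y => exact ⟨.hole, by rw [mem_vars_var.1 hx]; rfl⟩
  | func f ts ih =>
    obtain ⟨i, hi⟩ := mem_vars_func.1 hx
    obtain ⟨C, hC⟩ := ih i hi
    exact ⟨.arg f i C ts, by simp [Ctx.fill, ← hC]⟩

/-! ### Unification -/

/-- The number of symbols of a term. -/
def size : L.Term V → ℕ
  | .var _ => 1
  | .func _ ts => 1 + ∑ i, size (ts i)

theorem size_le_subst {t : L.Term V} {σ : V → L.Term V} {x : V} (hx : x ∈ vars t) :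
    size (σ x) ≤ size (t.subst σ) := by
  induction t with
  | var y => rw [mem_vars_var.1 hx]; rfl
  | func f ts ih =>
    obtain ⟨i, hi⟩ := mem_vars_func.1 hx
    have h := Finset.single_le_sum (f := fun j => size ((ts j).subst σ))
      (fun _ _ => Nat.zero_le _) (Finset.mem_univ i)
    have h' := ih i hi
    simp only [Term.subst, size] at h ⊢
    omega

/-- The occurs check. -/
theorem notMem_vars_of_subst_eq {n : ℕ} {f : L.Functions n} {ts : Fin n → L.Term V}
    {σ : V → L.Term V} {x : V} (h : σ x = (Term.func f ts).subst σ) :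
    x ∉ vars (Term.func f ts) := by
  intro hx
  obtain ⟨i, hi⟩ := mem_vars_func.1 hx
  have h₁ := size_le_subst (σ := σ) hi
  have h₂ := Finset.single_le_sum (f := fun j => size ((ts j).subst σ))
    (fun _ _ => Nat.zero_le _) (Finset.mem_univ i)
  rw [h] at h₁
  simp only [Term.subst, size] at h₁ h₂
  omega

/-- Two distinct unifiable terms have a disagreement pair: a variable `x` and a term `u` without
`x` that every unifier has to identify. -/
theorem exists_disagreement {s t : L.Term V} {τ : V → L.Term V} (hne : s ≠ t)
    (hτ : s.subst τ = t.subst τ) :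
    ∃ (x : V) (u : L.Term V), x ∉ vars u ∧ (x ∈ vars s ∨ x ∈ vars t) ∧
      (∀ y ∈ vars u, y ∈ vars s ∨ y ∈ vars t) ∧
      ∀ θ : V → L.Term V, s.subst θ = t.subst θ → θ x = u.subst θ := by
  induction s generalizing t with
  | var x =>
    refine ⟨x, t, ?_, Or.inl (mem_vars_var.2 rfl), fun _ => Or.inr, fun θ h => h⟩
    cases t with
    | var y => exact fun h => hne (by rw [mem_vars_var.1 h])
    | func g ts => exact notMem_vars_of_subst_eq hτ
  | @func n f ss ih =>
    cases t with
    | var y =>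
      exact ⟨y, _, notMem_vars_of_subst_eq hτ.symm, Or.inr (mem_vars_var.2 rfl),
        fun _ => Or.inl, fun θ h => h.symm⟩
    | @func m g ts =>
      simp only [Term.subst, Term.func.injEq] at hτ
      obtain ⟨rfl, hfg, hτ⟩ := hτ
      obtain rfl := eq_of_heq hfg
      replace hτ := congrFun (eq_of_heq hτ)
      obtain ⟨i, hi⟩ : ∃ i, ss i ≠ ts i := by
        by_contra! h
        exact hne (by rw [funext h])
      obtain ⟨x, u, h₁, h₂, h₃, h₄⟩ := ih i hi (hτ i)
      have hsub : ∀ y, (y ∈ vars (ss i) ∨ y ∈ vars (ts i)) →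
          y ∈ vars (Term.func f ss) ∨ y ∈ vars (Term.func f ts) := fun y =>
        Or.imp (fun h => mem_vars_func.2 ⟨i, h⟩) fun h => mem_vars_func.2 ⟨i, h⟩
      refine ⟨x, u, h₁, hsub x h₂, fun y hy => hsub y (h₃ y hy), fun θ hθ => h₄ θ ?_⟩
      simp only [Term.subst, Term.func.injEq, heq_eq_eq, true_and] at hθ
      exact congrFun hθ i

open Classical in
/-- Unifiable terms have a most general unifier: eliminate disagreement pairs, each of which
removes a variable. -/
theorem exists_isMGU {s t : L.Term V} {τ : V → L.Term V} (hτ : s.subst τ = t.subst τ) :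
    ∃ μ : V → L.Term V, IsMGU μ s t := by
  induction hn : (vars s ∪ vars t).card using Nat.strong_induction_on generalizing s t with
  | _ n ih =>
  by_cases hst : s = t
  · exact ⟨Term.var, by rw [hst], fun τ _ => ⟨τ, fun x => rfl⟩⟩
  obtain ⟨x, u, hxu, hx, hu, hall⟩ := exists_disagreement hst hτ
  -- Every unifier absorbs the elimination `ρ` of `x`, so it also unifies `sρ` and `tρ`.
  let ρ : V → L.Term V := Function.update Term.var x u
  have hρ : ∀ θ : V → L.Term V, s.subst θ = t.subst θ → ∀ y, (ρ y).subst θ = θ y := by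
    intro θ hθ y
    by_cases hy : y = x
    · subst hy; simp [ρ, hall θ hθ]
    · simp [ρ, hy, Term.subst]
  have hunif : ∀ θ : V → L.Term V, s.subst θ = t.subst θ →
      (s.subst ρ).subst θ = (t.subst ρ).subst θ := by
    intro θ hθ
    simp only [subst_subst, hρ θ hθ]
    exact hθ
  have hvars : ∀ y r, (∀ z ∈ vars r, z ∈ vars s ∨ z ∈ vars t) → y ∈ vars (r.subst ρ) →
      y ≠ x ∧ (y ∈ vars s ∨ y ∈ vars t) := by
    intro y r hr hy
    obtain ⟨z, hz, hyz⟩ := mem_vars_subst.1 hy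
    by_cases hzx : z = x
    · subst hzx
      simp only [ρ, Function.update_self] at hyz
      exact ⟨fun h => hxu (h ▸ hyz), hu y hyz⟩
    · simp only [ρ, Function.update_of_ne hzx] at hyz
      rw [mem_vars_var.1 hyz]
      exact ⟨hzx, hr z hz⟩
  have hcard : (vars (s.subst ρ) ∪ vars (t.subst ρ)).card < n := by
    rw [← hn]
    refine Finset.card_lt_card ⟨fun y hy => ?_, fun h => ?_⟩
    · rw [Finset.mem_union] at hy ⊢
      exact hy.elim (fun h => (hvars y s (fun _ => Or.inl) h).2)
        fun h => (hvars y t (fun _ => Or.inr) h).2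
    · have := h (Finset.mem_union.2 hx)
      rw [Finset.mem_union] at this
      exact this.elim (fun h => (hvars x s (fun _ => Or.inl) h).1 rfl)
        fun h => (hvars x t (fun _ => Or.inr) h).1 rfl
  obtain ⟨μ, hμ, hgen⟩ := ih _ hcard (hunif τ hτ) rfl
  refine ⟨fun y => (ρ y).subst μ, by simpa only [subst_subst] using hμ, fun θ hθ => ?_⟩
  obtain ⟨δ, hδ⟩ := hgen θ (hunif θ hθ)
  refine ⟨δ, fun y => ?_⟩
  rw [subst_subst, ← hρ θ hθ y]
  exact subst_congr fun z _ => hδ z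

open Classical in
theorem exists_perm_notMem [Infinite V] (A B : Finset V) :
    ∃ π : Equiv.Perm V, ∀ x ∈ A, π x ∉ B := by
  induction A using Finset.induction_on with
  | empty => exact ⟨1, by simp⟩
  | insert a A ha ih =>
    obtain ⟨π, hπ⟩ := ih
    obtain ⟨z, hz⟩ := Infinite.exists_notMem_finset (B ∪ A.image π)
    simp only [Finset.mem_union, Finset.mem_image, not_or, not_exists, not_and] at hz
    refine ⟨π.trans (Equiv.swap (π a) z), fun x hx => ?_⟩
    rw [Equiv.trans_apply]
    rcases Finset.mem_insert.1 hx with rfl | hx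
    · simpa using hz.1
    · have hxa : π x ≠ π a := fun h => ha (π.injective h ▸ hx)
      rw [Equiv.swap_apply_of_ne_of_ne hxa (hz.2 x hx)]
      exact hπ x hx

/-! ### Rewriting and conversion -/

theorem Step.of_mem {S : System L V} {l r : L.Term V} (h : (l, r) ∈ S) : Step S l r :=
  ⟨l, r, h, .hole, Term.var, by simp [Ctx.fill, subst_var], by simp [Ctx.fill, subst_var]⟩

theorem Step.update {S : System L V} {s t : L.Term V} (h : Step S s t) {n : ℕ}
    (f : L.Functions n) (i : Fin n) (ts : Fin n → L.Term V) :
    Step S (Term.func f (Function.update ts i s)) (Term.func f (Function.update ts i t)) := by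
  obtain ⟨l, r, hlr, C, σ, rfl, rfl⟩ := h
  exact ⟨l, r, hlr, .arg f i C ts, σ, rfl, rfl⟩

theorem Step.fill {S : System L V} {s t : L.Term V} (h : Step S s t) (C : Ctx L V) :
    Step S (C.fill s) (C.fill t) := by
  induction C with
  | hole => exact h
  | arg f i C ts ih => exact ih.update f i ts

theorem Step.subst {S : System L V} {s t : L.Term V} (h : Step S s t) (τ : V → L.Term V) :
    Step S (s.subst τ) (t.subst τ) := by
  obtain ⟨l, r, hlr, C, σ, rfl, rfl⟩ := h
  exact ⟨l, r, hlr, C.subst τ, fun x => (σ x).subst τ, by rw [Ctx.fill_subst, subst_subst],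
    by rw [Ctx.fill_subst, subst_subst]⟩

theorem Joinable.symm {S : System L V} {s t : L.Term V} (h : Joinable S s t) : Joinable S t s :=
  let ⟨w, h₁, h₂⟩ := h
  ⟨w, h₂, h₁⟩

theorem Joinable.map {S : System L V} {g : L.Term V → L.Term V}
    (hg : ∀ s t, Step S s t → Step S (g s) (g t)) {s t : L.Term V} (h : Joinable S s t) :
    Joinable S (g s) (g t) :=
  let ⟨w, h₁, h₂⟩ := h
  ⟨g w, h₁.lift g hg, h₂.lift g hg⟩

theorem reflTransGen_func {S : System L V} {n : ℕ} {f : L.Functions n} {ss ts : Fin n → L.Term V}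
    (h : ∀ i, ReflTransGen (Step S) (ss i) (ts i)) :
    ReflTransGen (Step S) (Term.func f ss) (Term.func f ts) := by
  have key : ∀ A : Finset (Fin n),
      ReflTransGen (Step S) (Term.func f ss) (Term.func f (A.piecewise ts ss)) := by
    intro A
    induction A using Finset.induction_on with
    | empty => simpa using ReflTransGen.refl
    | insert i A hi ih =>
      refine ih.trans ?_
      have : ReflTransGen (Step S)
          (Term.func f (Function.update (A.piecewise ts ss) i (ss i)))
          (Term.func f (Function.update (A.piecewise ts ss) i (ts i))) :=
        (h i).lift (fun t => Term.func f (Function.update (A.piecewise ts ss) i t))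
          fun s t hst => hst.update f i _
      rw [Finset.piecewise_insert]
      rwa [← Finset.piecewise_eq_of_notMem A ts ss hi, Function.update_eq_self] at this
  simpa using key Finset.univ

theorem reflTransGen_subst {S : System L V} {σ τ : V → L.Term V}
    (h : ∀ x, ReflTransGen (Step S) (σ x) (τ x)) (t : L.Term V) :
    ReflTransGen (Step S) (t.subst σ) (t.subst τ) := by
  induction t with
  | var x => exact h x
  | func f ts ih => exact reflTransGen_func ih

theorem Conv.map {S T : System L V} {g : L.Term V → L.Term V}
    (hg : ∀ s t, Step S s t → Conv T (g s) (g t)) {s t : L.Term V} (h : Conv S s t) :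
    Conv T (g s) (g t) := by
  induction h with
  | rel s t h => exact hg s t h
  | refl s => exact .refl _
  | symm s t _ ih => exact .symm _ _ ih
  | trans s t u _ _ ih₁ ih₂ => exact .trans _ _ _ ih₁ ih₂

theorem Conv.of_mem {S : System L V} {l r : L.Term V} (h : (l, r) ∈ S) : Conv S l r :=
  .rel _ _ (.of_mem h)

theorem Conv.fill {S : System L V} {s t : L.Term V} (h : Conv S s t) (C : Ctx L V) :
    Conv S (C.fill s) (C.fill t) :=
  h.map fun _ _ h => .rel _ _ (h.fill C)

theorem Conv.subst {S : System L V} {s t : L.Term V} (h : Conv S s t) (σ : V → L.Term V) :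
    Conv S (s.subst σ) (t.subst σ) :=
  h.map (g := fun t => t.subst σ) fun _ _ h => .rel _ _ (h.subst σ)

theorem Conv.of_step {S T : System L V} (h : ∀ l r, (l, r) ∈ S → Conv T l r) {s t : L.Term V}
    (hst : Step S s t) : Conv T s t := by
  obtain ⟨l, r, hlr, C, σ, rfl, rfl⟩ := hst
  exact ((h l r hlr).subst σ).fill C

theorem Conv.le {S T : System L V} (h : ∀ l r, (l, r) ∈ S → Conv T l r) {s t : L.Term V}
    (hst : Conv S s t) : Conv T s t :=
  hst.map (g := id) fun _ _ => .of_step h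

theorem Conv.mono {S T : System L V} (h : S ⊆ T) {s t : L.Term V} (hst : Conv S s t) :
    Conv T s t :=
  hst.le fun _ _ hlr => .of_mem (h hlr)

theorem Conv.eq {S T : System L V} (h : ∀ l r, (l, r) ∈ S → Conv T l r)
    (h' : ∀ l r, (l, r) ∈ T → Conv S l r) : Conv S = Conv T := by
  funext s t
  exact propext ⟨.le h, .le h'⟩

theorem Joinable.conv {S : System L V} {s t : L.Term V} (h : Joinable S s t) : Conv S s t :=
  let ⟨_, h₁, h₂⟩ := h
  .trans _ _ _ (EqvGen.reflTransGen_le_eqvGen _ _ _ h₁) (.symm _ _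
    (EqvGen.reflTransGen_le_eqvGen _ _ _ h₂))

/-- **Newman's lemma**, relative to a set closed under the relation. -/
theorem join_of_locally_confluent {α : Type*} {r : α → α → Prop} {P : α → Prop}
    (wf : WellFounded fun b a => r a b) (hP : ∀ a b, P a → r a b → P b)
    (h : ∀ a b c, P a → r a b → r a c → Join (ReflTransGen r) b c) :
    ∀ a b c, P a → ReflTransGen r a b → ReflTransGen r a c → Join (ReflTransGen r) b c := by
  intro a
  induction a using wf.induction with
  | _ a ih =>
  intro b c ha hb hc
  rcases hb.cases_head with rfl | ⟨b', hab, hb⟩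
  · exact ⟨c, hc, .refl⟩
  rcases hc.cases_head with rfl | ⟨c', hac, hc⟩
  · exact ⟨b, .refl, .head hab hb⟩
  obtain ⟨d, hbd, hcd⟩ := h a b' c' ha hab hac
  obtain ⟨e, hbe, hde⟩ := ih b' hab b d (hP _ _ ha hab) hb hbd
  obtain ⟨k, hek, hck⟩ := ih c' hac e c (hP _ _ ha hac) (hcd.trans hde) hc
  exact ⟨k, hbe.trans hek, hck⟩

/-! ### Ordered rewriting -/

variable {gt : L.Term V → L.Term V → Prop} {R E : System L V}

theorem Conv.of_mem_union {s t : L.Term V} (h : (s, t) ∈ R ∪ symCl E) : Conv (R ∪ E) s t := by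
  rcases h with h | h | h
  · exact .of_mem (Or.inl h)
  · exact .of_mem (Or.inr h)
  · exact .symm _ _ (Conv.of_mem (Or.inr h))

theorem Conv.of_ordSys_step {s t : L.Term V} (h : Step (ordSys gt R E) s t) :
    Conv (R ∪ E) s t := by
  refine .of_step ?_ h
  rintro _ _ ⟨l, r, hlr, σ, -, ⟨⟩⟩
  exact (Conv.of_mem_union hlr).subst σ

theorem ordSys_step {l r : L.Term V} (h : (l, r) ∈ R ∪ symCl E) {σ : V → L.Term V}
    (hσ : gt (l.subst σ) (r.subst σ)) : Step (ordSys gt R E) (l.subst σ) (r.subst σ) :=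
  .of_mem ⟨l, r, h, σ, hσ, rfl⟩

theorem exists_of_ordSys_step (hgt : IsReductionOrder gt) {s t : L.Term V}
    (h : Step (ordSys gt R E) s t) :
    ∃ l r : L.Term V, (l, r) ∈ R ∪ symCl E ∧ ∃ (C : Ctx L V) (σ : V → L.Term V),
      gt (l.subst σ) (r.subst σ) ∧ s = C.fill (l.subst σ) ∧ t = C.fill (r.subst σ) := by
  obtain ⟨_, _, ⟨l, r, hlr, σ, hσ, ⟨⟩⟩, C, τ, rfl, rfl⟩ := h
  refine ⟨l, r, hlr, C, fun x => (σ x).subst τ, ?_, ?_, ?_⟩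
  · simpa only [subst_subst] using hgt.subst τ _ _ hσ
  · rw [subst_subst]
  · rw [subst_subst]

theorem gt_of_ordSys_step (hgt : IsReductionOrder gt) {s t : L.Term V}
    (h : Step (ordSys gt R E) s t) : gt s t := by
  obtain ⟨l, r, -, C, σ, hσ, rfl, rfl⟩ := exists_of_ordSys_step hgt h
  exact hgt.ctx C _ _ hσ

theorem terminating_ordSys (hgt : IsReductionOrder gt) : Terminating (ordSys gt R E) :=
  Subrelation.wf (fun h => gt_of_ordSys_step hgt h) hgt.wf

theorem IsReductionOrder.asymm (hgt : IsReductionOrder gt) {s t : L.Term V} (h : gt s t) :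
    ¬ gt t s :=
  fun h' => hgt.wf.irrefl.irrefl s (hgt.trans _ _ _ h h')

/-- Otherwise `s > C[s] > C[C[s]] > ⋯`. -/
theorem IsReductionOrder.not_gt_fill (hgt : IsReductionOrder gt) (C : Ctx L V) (s : L.Term V) :
    ¬ gt s (C.fill s) := by
  induction s using hgt.wf.induction with
  | _ s ih => exact fun h => ih _ h (hgt.ctx C _ _ h)

/-- A variable of `t` could be instantiated by `s`, which makes `s` a subterm of a smaller
term. -/
theorem ground_of_gt (hgt : IsReductionOrder gt) {s t : L.Term V} (hs : Ground s)
    (h : gt s t) : Ground t := by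
  rw [ground_iff]
  intro x hx
  obtain ⟨C, rfl⟩ := exists_ctx_of_mem_vars hx
  have h' := hgt.subst (fun _ => s) _ _ h
  rw [hs.subst_eq, Ctx.fill_subst] at h'
  exact hgt.not_gt_fill _ _ h'

theorem ground_of_reflTransGen (hgt : IsReductionOrder gt) {s t : L.Term V} (hs : Ground s)
    (h : ReflTransGen (Step (ordSys gt R E)) s t) : Ground t := by
  induction h with
  | refl => exact hs
  | tail _ h ih => exact ground_of_gt hgt ih (gt_of_ordSys_step hgt h)

/-- Totality of the order turns ground instances of a pair into at most one rewrite step. An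
instance of a rule cannot be increasing, and an increasing instance of an equation is used
backwards. -/
theorem joinable_of_ground (hgt : IsReductionOrder gt) (htotal : GroundTotal gt)
    (hR : ∀ l r, (l, r) ∈ R → gt l r) {l r : L.Term V} (h : (l, r) ∈ R ∪ symCl E)
    {σ : V → L.Term V} (hl : Ground (l.subst σ)) (hr : Ground (r.subst σ)) :
    Joinable (ordSys gt R E) (l.subst σ) (r.subst σ) := by
  rcases htotal _ _ hl hr with heq | hlt | hlt
  · rw [heq]
    exact ⟨_, .refl, .refl⟩
  · exact ⟨_, .single (ordSys_step h hlt), .refl⟩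
  · have h' : (r, l) ∈ R ∪ symCl E := by
      rcases h with h | h | h
      · exact absurd hlt (hgt.asymm (hgt.subst σ _ _ (hR _ _ h)))
      · exact Or.inr (Or.inr h)
      · exact Or.inr (Or.inl h)
    exact ⟨_, .refl, .single (ordSys_step h' hlt)⟩

/-! ### Critical pairs and ground confluence -/

/-- The position of a subterm `w` of an instance `tσ = D[w]` is either a non-variable position of
`t` or lies below a variable `x` of `t`. In the latter case, rewriting `w` to `v` can be completed
to the change of `σ` at `x`, by repeating the step at the other occurrences of `x`. -/
theorem fill_eq_subst {t w : L.Term V} {D : Ctx L V} {σ : V → L.Term V}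
    (h : D.fill w = t.subst σ) :
    (∃ (C : Ctx L V) (u : L.Term V), t = C.fill u ∧ ¬ IsVar u ∧ w = u.subst σ ∧
      ∀ v, D.fill v = (C.subst σ).fill v) ∨
    ∃ (x : V) (D' : Ctx L V), σ x = D'.fill w ∧
      ∀ (S : System L V) (v : L.Term V), Step S w v → ∀ σ', (∀ y, y ≠ x → σ' y = σ y) →
        σ' x = D'.fill v → ReflTransGen (Step S) (D.fill v) (t.subst σ') := by
  induction t generalizing D with
  | var x =>
    refine Or.inr ⟨x, D, h.symm, fun S v _ σ' _ hx => ?_⟩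
    rw [← hx]
    exact .refl
  | @func n f ts ih =>
    cases D with
    | hole =>
      refine Or.inl ⟨.hole, Term.func f ts, rfl, ?_, h, fun v => rfl⟩
      rintro ⟨x, ⟨⟩⟩
    | @arg m g i D us =>
      simp only [Ctx.fill, Term.subst, Term.func.injEq] at h
      obtain ⟨rfl, hfg, h⟩ := h
      obtain rfl := eq_of_heq hfg
      replace h := congrFun (eq_of_heq h)
      have hi : D.fill w = (ts i).subst σ := by simpa using h i
      have hj : ∀ j, j ≠ i → us j = (ts j).subst σ := fun j hj => by simpa [hj] using h j
      rcases ih i hi with ⟨C, u, hC, hu, hw, hv⟩ | ⟨x, D', hx, hv⟩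
      · refine Or.inl ⟨.arg g i C ts, u, by simp [Ctx.fill, ← hC], hu, hw, fun v => ?_⟩
        simp only [Ctx.fill, Ctx.subst, hv]
        congr 1
        funext j
        by_cases hji : j = i
        · subst hji; simp
        · simp [hji, hj j hji]
      · refine Or.inr ⟨x, D', hx, fun S v hwv σ' hne hσ' => reflTransGen_func fun j => ?_⟩
        by_cases hji : j = i
        · subst hji
          simpa using hv S v hwv σ' hne hσ'
        · rw [Function.update_of_ne hji, hj j hji]
          refine reflTransGen_subst (fun y => ?_) _
          by_cases hy : y = x
          · subst hy
            rw [hx, hσ']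
            exact .single (hwv.fill D')
          · rw [hne y hy]

/-- An overlap of two decreasing instances is an instance of an extended critical pair. -/
theorem exists_ECP_of_overlap [Infinite V] (hgt : IsReductionOrder gt) {F : System L V}
    {l₁ r₁ l₂ r₂ u : L.Term V} {C : Ctx L V} {σ₁ σ₂ : V → L.Term V}
    (h₁ : (l₁, r₁) ∈ F) (h₂ : (l₂, r₂) ∈ F)
    (hσ₁ : gt (l₁.subst σ₁) (r₁.subst σ₁)) (hσ₂ : gt (l₂.subst σ₂) (r₂.subst σ₂))
    (hl₂ : l₂ = C.fill u) (hu : ¬ IsVar u) (heq : l₁.subst σ₁ = u.subst σ₂) :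
    ∃ (s t : L.Term V) (δ : V → L.Term V), (s, t) ∈ ECP gt F ∧
      s.subst δ = (C.subst σ₂).fill (r₁.subst σ₁) ∧ t.subst δ = r₂.subst σ₂ := by
  classical
  obtain ⟨π, hπ⟩ := exists_perm_notMem (vars l₁ ∪ vars r₁) (vars l₂ ∪ vars r₂)
  -- The common instance of the renamed first pair and the second pair.
  let τ : V → L.Term V := fun x => if x ∈ vars l₂ ∪ vars r₂ then σ₂ x else σ₁ (π.symm x)
  have hτ₂ : ∀ x ∈ vars l₂ ∪ vars r₂, τ x = σ₂ x := fun x hx => if_pos hx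
  have hτ₁ : ∀ x ∈ vars l₁ ∪ vars r₁, τ (π x) = σ₁ x := fun x hx => by
    simp only [τ, if_neg (hπ x hx), Equiv.symm_apply_apply]
  have hl₁τ : (l₁.relabel π).subst τ = l₁.subst σ₁ := by
    rw [subst_relabel]
    exact subst_congr fun x hx => hτ₁ x (Finset.mem_union_left _ hx)
  have hr₁τ : (r₁.relabel π).subst τ = r₁.subst σ₁ := by
    rw [subst_relabel]
    exact subst_congr fun x hx => hτ₁ x (Finset.mem_union_right _ hx)
  have hl₂τ : l₂.subst τ = l₂.subst σ₂ :=
    subst_congr fun x hx => hτ₂ x (Finset.mem_union_left _ hx)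
  have hr₂τ : r₂.subst τ = r₂.subst σ₂ :=
    subst_congr fun x hx => hτ₂ x (Finset.mem_union_right _ hx)
  have hvu : ∀ x ∈ vars u, x ∈ vars l₂ := by
    intro x hx
    exact hl₂ ▸ Ctx.mem_vars_fill C hx
  have huτ : u.subst τ = u.subst σ₂ :=
    subst_congr fun x hx => hτ₂ x (Finset.mem_union_left _ (hvu x hx))
  have hunif : (l₁.relabel π).subst τ = u.subst τ := by rw [hl₁τ, huτ, heq]
  obtain ⟨μ, hμ⟩ := exists_isMGU hunif
  obtain ⟨δ, hδ⟩ := hμ.2 τ hunif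
  have hμδ : ∀ t : L.Term V, (t.subst μ).subst δ = t.subst τ := fun t => by
    rw [subst_subst]
    exact subst_congr fun x _ => (hδ x).symm
  refine ⟨_, _, δ, ⟨l₁.relabel π, r₁.relabel π, l₂, r₂, ⟨_, Or.inl h₁, π, rfl⟩,
    ⟨_, Or.inl h₂, Equiv.refl V, ?_⟩, ?_, C, u, μ, hl₂, hu, hμ, ?_, ?_, rfl⟩, ?_, ?_⟩
  · simp [rename]
  · intro x hx hx'
    simp only [mem_vars_relabel] at hx
    rcases hx with ⟨y, hy, rfl⟩ | ⟨y, hy, rfl⟩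
    · exact hπ y (Finset.mem_union_left _ hy) (Finset.mem_union.2 hx')
    · exact hπ y (Finset.mem_union_right _ hy) (Finset.mem_union.2 hx')
  · intro h
    have h' := hgt.subst δ _ _ h
    rw [hμδ, hμδ, hl₁τ, hr₁τ] at h'
    exact hgt.asymm hσ₁ h'
  · intro h
    have h' := hgt.subst δ _ _ h
    rw [hμδ, hμδ, hl₂τ, hr₂τ] at h'
    exact hgt.asymm hσ₂ h'
  · rw [hμδ, Ctx.fill_subst, hr₁τ]
    exact Ctx.subst_fill_congr (u := u)
      (fun x hx => hτ₂ x (Finset.mem_union_left _ (hl₂ ▸ hx))) _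
  · rw [hμδ, hr₂τ]

/-- The hypothesis on critical pairs: every extended critical pair is joinable or an instance of an
equation. -/
def CriticalPairsJoin (gt : L.Term V → L.Term V → Prop) (R E : System L V) : Prop :=
  ∀ s t : L.Term V, (s, t) ∈ ECP gt (symCl E ∪ R) →
    Joinable (ordSys gt R E) s t ∨ IsInstance (symCl E) s t

/-- A nested peak of ground terms: the outer redex is the whole term. -/
theorem joinable_of_root_peak [Infinite V] (hgt : IsReductionOrder gt) (htotal : GroundTotal gt)
    (hR : ∀ l r, (l, r) ∈ R → gt l r) (hcp : CriticalPairsJoin gt R E)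
    {l₁ r₁ l₂ r₂ : L.Term V} {D : Ctx L V} {σ₁ σ₂ : V → L.Term V}
    (h₁ : (l₁, r₁) ∈ R ∪ symCl E) (h₂ : (l₂, r₂) ∈ R ∪ symCl E)
    (hσ₁ : gt (l₁.subst σ₁) (r₁.subst σ₁)) (hσ₂ : gt (l₂.subst σ₂) (r₂.subst σ₂))
    (heq : D.fill (l₁.subst σ₁) = l₂.subst σ₂) (hground : Ground (l₂.subst σ₂)) :
    Joinable (ordSys gt R E) (D.fill (r₁.subst σ₁)) (r₂.subst σ₂) := by
  classical
  have hg₁ : Ground (D.fill (r₁.subst σ₁)) :=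
    ground_of_gt hgt hground (heq ▸ hgt.ctx D _ _ hσ₁)
  have hg₂ : Ground (r₂.subst σ₂) := ground_of_gt hgt hground hσ₂
  rcases fill_eq_subst heq with ⟨C, u, hC, hu, hw, hv⟩ | ⟨x, D', hx, hv⟩
  -- Overlap at a non-variable position of `l₂`.
  · have hmem : ∀ e, e ∈ R ∪ symCl E → e ∈ symCl E ∪ R := fun _ => Or.symm
    obtain ⟨s, t, δ, hst, hs, ht⟩ :=
      exists_ECP_of_overlap hgt (hmem _ h₁) (hmem _ h₂) hσ₁ hσ₂ hC hu hw
    rw [← hv] at hs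
    rw [← hs] at hg₁ ⊢
    rw [← ht] at hg₂ ⊢
    rcases hcp s t hst with h | ⟨s', t', h, σ, rfl, rfl⟩
    · exact h.map (g := fun t => t.subst δ) fun _ _ h => h.subst δ
    · rw [subst_subst] at hg₁ hg₂ ⊢
      rw [subst_subst]
      exact joinable_of_ground hgt htotal hR (Or.inr h) hg₁ hg₂
  -- Variable overlap: both reducts rewrite to the ground instances of `l₂`, `r₂` under `σ'`.
  · let σ' := Function.update σ₂ x (D'.fill (r₁.subst σ₁))
    have hstep := ordSys_step h₁ hσ₁
    have hl : ReflTransGen (Step (ordSys gt R E)) (D.fill (r₁.subst σ₁)) (l₂.subst σ') :=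
      hv _ _ hstep σ' (fun y hy => by simp [σ', hy]) (by simp [σ'])
    have hr : ReflTransGen (Step (ordSys gt R E)) (r₂.subst σ₂) (r₂.subst σ') := by
      refine reflTransGen_subst (fun y => ?_) _
      by_cases hy : y = x
      · subst hy
        simp only [σ', hx, Function.update_self]
        exact .single (hstep.fill D')
      · simp only [σ', Function.update_of_ne hy]
        exact .refl
    obtain ⟨w, hw₁, hw₂⟩ := joinable_of_ground hgt htotal hR h₂ (σ := σ')
      (ground_of_reflTransGen hgt hg₁ hl) (ground_of_reflTransGen hgt hg₂ hr)
    exact ⟨w, hl.trans hw₁, hr.trans hw₂⟩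

theorem joinable_of_peak [Infinite V] (hgt : IsReductionOrder gt) (htotal : GroundTotal gt)
    (hR : ∀ l r, (l, r) ∈ R → gt l r) (hcp : CriticalPairsJoin gt R E)
    {l₁ r₁ l₂ r₂ : L.Term V} {C₁ C₂ : Ctx L V} {σ₁ σ₂ : V → L.Term V}
    (h₁ : (l₁, r₁) ∈ R ∪ symCl E) (h₂ : (l₂, r₂) ∈ R ∪ symCl E)
    (hσ₁ : gt (l₁.subst σ₁) (r₁.subst σ₁)) (hσ₂ : gt (l₂.subst σ₂) (r₂.subst σ₂))
    (heq : C₁.fill (l₁.subst σ₁) = C₂.fill (l₂.subst σ₂))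
    (hground : Ground (C₂.fill (l₂.subst σ₂))) :
    Joinable (ordSys gt R E) (C₁.fill (r₁.subst σ₁)) (C₂.fill (r₂.subst σ₂)) := by
  induction C₁ generalizing C₂ with
  | hole =>
    exact (joinable_of_root_peak hgt htotal hR hcp h₂ h₁ hσ₂ hσ₁ heq.symm
      (by rw [← heq] at hground; exact hground)).symm
  | @arg n f i C₁ ts ih =>
    cases C₂ with
    | hole => exact joinable_of_root_peak hgt htotal hR hcp h₁ h₂ hσ₁ hσ₂ heq hground
    | @arg m g j C₂ us =>
      simp only [Ctx.fill, Term.func.injEq] at heq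
      obtain ⟨rfl, hfg, heq⟩ := heq
      obtain rfl := eq_of_heq hfg
      replace heq := congrFun (eq_of_heq heq)
      simp only [Ctx.fill]
      by_cases hij : i = j
      · subst hij
        have hts : ∀ t, Function.update ts i t = Function.update us i t := by
          intro t
          funext k
          by_cases hk : k = i
          · subst hk; simp
          · simpa [hk] using heq k
        rw [hts]
        exact (ih (by simpa using heq i) (by simpa using ground_func.1 hground i)).map
          fun _ _ h => h.update f i us
      -- Parallel redexes: each reduct allows the other step.
      · have hj : ts j = C₂.fill (l₂.subst σ₂) := by simpa [Ne.symm hij] using heq j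
        have hi : us i = C₁.fill (l₁.subst σ₁) := by simpa [hij] using (heq i).symm
        have s₁ := ((ordSys_step h₁ hσ₁).fill C₁).update f i
          (Function.update us j (C₂.fill (r₂.subst σ₂)))
        have s₂ := ((ordSys_step h₂ hσ₂).fill C₂).update f j
          (Function.update ts i (C₁.fill (r₁.subst σ₁)))
        refine ⟨Term.func f (Function.update (Function.update ts i (C₁.fill (r₁.subst σ₁))) j
          (C₂.fill (r₂.subst σ₂))), .single ?_, .single ?_⟩
        · convert s₂ using 2
          exact (Function.update_eq_self_iff.2 (by simp [Ne.symm hij, hj])).symm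
        · convert s₁ using 2
          · exact (Function.update_eq_self_iff.2 (by simp [hij, hi])).symm
          · funext k
            by_cases hk : k = i
            · subst hk; simp [hij]
            · by_cases hk' : k = j
              · subst hk'; simp [hk]
              · simpa [hk, hk'] using heq k

theorem groundConfluent_ordSys [Infinite V] (hgt : IsReductionOrder gt)
    (htotal : GroundTotal gt) (hR : ∀ l r, (l, r) ∈ R → gt l r)
    (hcp : CriticalPairsJoin gt R E) : GroundConfluent (ordSys gt R E) := by
  refine join_of_locally_confluent (terminating_ordSys hgt)
    (fun s t hs h => ground_of_gt hgt hs (gt_of_ordSys_step hgt h)) fun s t u hs ht hu => ?_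
  obtain ⟨l₁, r₁, h₁, C₁, σ₁, hσ₁, rfl, rfl⟩ := exists_of_ordSys_step hgt ht
  obtain ⟨l₂, r₂, h₂, C₂, σ₂, hσ₂, heq, rfl⟩ := exists_of_ordSys_step hgt hu
  exact joinable_of_peak hgt htotal hR hcp h₁ h₂ hσ₁ hσ₂ heq (heq ▸ hs)

/-- A conversion by `R ∪ E` becomes one by ordered rewriting once all variables are replaced by
ground terms, including those that occur only in intermediate terms. -/
theorem conv_ordSys_subst (hgt : IsReductionOrder gt) (htotal : GroundTotal gt)
    (hR : ∀ l r, (l, r) ∈ R → gt l r) {σ : V → L.Term V} (hσ : ∀ x, Ground (σ x))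
    {s t : L.Term V} (h : Conv (R ∪ E) s t) :
    Conv (ordSys gt R E) (s.subst σ) (t.subst σ) := by
  refine h.map (g := fun t => t.subst σ) ?_
  rintro _ _ ⟨l, r, hlr, C, τ, rfl, rfl⟩
  simp only [Ctx.fill_subst, subst_subst]
  have hg : ∀ t : L.Term V, Ground (t.subst fun x => (τ x).subst σ) := fun t =>
    ground_subst fun _ _ => ground_subst fun x _ => hσ x
  exact (joinable_of_ground hgt htotal hR (hlr.imp id Or.inl) (hg l) (hg r)).conv.fill _

/-! ### Soundness of the inference steps -/

theorem conv_rename_iff {S : System L V} {s t : L.Term V} (π : Equiv.Perm V) :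
    Conv S (s.relabel π) (t.relabel π) ↔ Conv S s t := by
  refine ⟨fun h => ?_, fun h => ?_⟩
  · have h' := h.subst fun x => Term.var (π.symm x)
    simpa only [subst_relabel, Equiv.symm_apply_apply, subst_var] using h'
  · simpa only [relabel_eq_subst] using h.subst fun x => Term.var (π x)

/-- Replacing one pair by a variant of a pair whose sides are convertible to the old ones. -/
theorem conv_eq_of_replace {A S T : System L V} {s t s' t' : L.Term V} {π : Equiv.Perm V}
    (hs : Conv A s s') (ht : Conv A t t') (hS : ∀ e, e ∈ S ↔ e ∈ A ∨ e = (s, t))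
    (hT : ∀ e, e ∈ T ↔ e ∈ A ∨ e = rename π (s', t')) : Conv S = Conv T := by
  have hAS : A ⊆ S := fun e he => (hS e).2 (Or.inl he)
  have hAT : A ⊆ T := fun e he => (hT e).2 (Or.inl he)
  refine Conv.eq (fun l r h => ?_) fun l r h => ?_
  · rcases (hS _).1 h with h | h
    · exact .of_mem (hAT h)
    · obtain ⟨rfl, rfl⟩ := Prod.mk.inj h
      have h' : Conv T s' t' := (conv_rename_iff π).1 (.of_mem ((hT _).2 (Or.inr rfl)))
      exact .trans _ _ _ (hs.mono hAT) (.trans _ _ _ h' (.symm _ _ (ht.mono hAT)))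
  · rcases (hT _).1 h with h | h
    · exact .of_mem (hAS h)
    · obtain ⟨rfl, rfl⟩ := Prod.mk.inj h
      have h' : Conv S s t := .of_mem ((hS _).2 (Or.inr rfl))
      exact (conv_rename_iff π).2
        (.trans _ _ _ (.symm _ _ (hs.mono hAS)) (.trans _ _ _ h' (ht.mono hAS)))

theorem conv_union_singleton {A S : System L V} {s t : L.Term V} (h : Conv A s t)
    (hS : ∀ e, e ∈ S ↔ e ∈ A ∨ e = (s, t)) : Conv S = Conv A := by
  refine Conv.eq (fun l r hlr => ?_) fun l r hlr => .of_mem ((hS _).2 (Or.inl hlr))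
  rcases (hS _).1 hlr with hlr | hlr
  · exact .of_mem hlr
  · obtain ⟨rfl, rfl⟩ := Prod.mk.inj hlr
    exact h

theorem OKB.conv_eq {p q : System L V × System L V} (h : OKB gt p q) :
    Conv (p.2 ∪ p.1) = Conv (q.2 ∪ q.1) := by
  have hrefl : ∀ (S : System L V) (t : L.Term V), Conv S t t := fun S t => .refl t
  cases h with
  | deduce E R s t u π hs ht =>
    have hconv : ∀ t, Step (R ∪ symCl E) u t → Conv (R ∪ E) u t := fun t =>
      .of_step fun _ _ => Conv.of_mem_union
    refine (conv_union_singleton ((conv_rename_iff π).2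
      (.trans _ _ _ (.symm _ _ (hconv s hs)) (hconv t ht))) fun e => ?_).symm
    simp only [Set.mem_union, Set.mem_singleton_iff, rename]; tauto
  | orientLR E R s t π hd h =>
    refine conv_eq_of_replace (A := R ∪ E) (π := π) (hrefl _ s) (hrefl _ t)
      (fun e => ?_) fun e => ?_ <;>
      simp only [Set.mem_union, Set.mem_singleton_iff] <;> tauto
  | orientRL E R s t π hd h =>
    have hswap : Conv (R ∪ (E ∪ {(s, t)})) = Conv (R ∪ (E ∪ {(t, s)})) := by
      refine Conv.eq ?_ ?_ <;> rintro l r (h | h | h)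
      · exact .of_mem (Or.inl h)
      · exact .of_mem (Or.inr (Or.inl h))
      · obtain ⟨rfl, rfl⟩ := Prod.mk.inj h
        exact .symm _ _ (Conv.of_mem (Or.inr (Or.inr rfl)))
      · exact .of_mem (Or.inl h)
      · exact .of_mem (Or.inr (Or.inl h))
      · obtain ⟨rfl, rfl⟩ := Prod.mk.inj h
        exact .symm _ _ (Conv.of_mem (Or.inr (Or.inr rfl)))
    refine hswap.trans (conv_eq_of_replace (A := R ∪ E) (π := π) (hrefl _ t) (hrefl _ s)
      (fun e => ?_) fun e => ?_)
    · simp only [Set.mem_union, Set.mem_singleton_iff]; tauto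
    · simp only [Set.mem_union, Set.mem_singleton_iff]; tauto
  | delete E R s hd =>
    refine conv_union_singleton (hrefl _ s) fun e => ?_
    simp only [Set.mem_union, Set.mem_singleton_iff]; tauto
  | compose E R s t u π hd h =>
    refine conv_eq_of_replace (A := R ∪ E) (π := π) (hrefl _ s) (.of_ordSys_step h)
      (fun e => ?_) fun e => ?_ <;>
      simp only [Set.mem_union, Set.mem_singleton_iff] <;> tauto
  | simplifyL E R s t u π hd h =>
    refine conv_eq_of_replace (A := R ∪ E) (π := π) (.of_ordSys_step h) (hrefl _ t)
      (fun e => ?_) fun e => ?_ <;>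
      simp only [Set.mem_union, Set.mem_singleton_iff] <;> tauto
  | simplifyR E R s t u π hd h =>
    refine conv_eq_of_replace (A := R ∪ E) (π := π) (hrefl _ s) (.of_ordSys_step h)
      (fun e => ?_) fun e => ?_ <;>
      simp only [Set.mem_union, Set.mem_singleton_iff] <;> tauto
  | collapse E R t s u π hd h =>
    refine conv_eq_of_replace (A := R ∪ E) (π := π) (.of_ordSys_step h) (hrefl _ s)
      (fun e => ?_) fun e => ?_ <;>
      simp only [Set.mem_union, Set.mem_singleton_iff] <;> tauto

theorem gt_rename (hgt : IsReductionOrder gt) {s t : L.Term V} (h : gt s t) (π : Equiv.Perm V) :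
    gt (rename π (s, t)).1 (rename π (s, t)).2 := by
  simpa only [rename, relabel_eq_subst] using hgt.subst (fun x => Term.var (π x)) _ _ h

theorem OKB.rules_gt (hgt : IsReductionOrder gt) {p q : System L V × System L V}
    (h : OKB gt p q) (hp : ∀ e ∈ p.2, gt e.1 e.2) : ∀ e ∈ q.2, gt e.1 e.2 := by
  cases h with
  | deduce | delete | simplifyL | simplifyR => exact hp
  | orientLR E R s t π hd h | orientRL E R s t π hd h =>
    rintro e (he | rfl)
    · exact hp e he
    · exact gt_rename hgt h π
  | compose E R s t u π hd h =>
    rintro e (he | rfl)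
    · exact hp e (Or.inl he)
    · exact gt_rename hgt
        (hgt.trans _ _ _ (hp (s, t) (Or.inr rfl)) (gt_of_ordSys_step hgt h)) π
  | collapse E R t s u π hd h => exact fun e he => hp e (Or.inl he)

theorem Run.conv_eq {p q : System L V × System L V} (h : Run gt p q) :
    Conv (p.2 ∪ p.1) = Conv (q.2 ∪ q.1) := by
  induction h with
  | refl => rfl
  | tail _ h ih => exact ih.trans h.conv_eq

theorem Run.rules_gt (hgt : IsReductionOrder gt) {p q : System L V × System L V}
    (h : Run gt p q) (hp : ∀ e ∈ p.2, gt e.1 e.2) : ∀ e ∈ q.2, gt e.1 e.2 := by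
  induction h with
  | refl => exact hp
  | tail _ h ih => exact h.rules_gt hgt ih

end OrdCompletion

theorem theorem1 {L : FirstOrder.Language.{u, v}} {V : Type w} [Infinite V]
    (gt : L.Term V → L.Term V → Prop)
    (hgt : OrdCompletion.IsReductionOrder gt)
    (htotal : OrdCompletion.GroundTotal gt)
    (c : L.Constants) (hc : OrdCompletion.IsMinimalConstant gt c)
    (E₀ E R : OrdCompletion.System L V)
    (hrun : OrdCompletion.Run gt (E₀, ∅) (E, R))
    (hecp : ∀ s t : L.Term V,
      (s, t) ∈ OrdCompletion.ECP gt (OrdCompletion.symCl E ∪ R) →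
        OrdCompletion.Joinable (OrdCompletion.ordSys gt R E) s t ∨
          OrdCompletion.IsInstance (OrdCompletion.symCl E) s t) :
    OrdCompletion.Conv E₀ = OrdCompletion.Conv (R ∪ E) ∧
      OrdCompletion.GroundComplete (OrdCompletion.ordSys gt R E) ∧
      OrdCompletion.GroundPresentation (OrdCompletion.ordSys gt R E) E₀ := by
  have hconv : OrdCompletion.Conv E₀ = OrdCompletion.Conv (R ∪ E) := by
    simpa using OrdCompletion.Run.conv_eq hrun
  have hR : ∀ l r, (l, r) ∈ R → gt l r := fun l r h =>
    OrdCompletion.Run.rules_gt hgt hrun (by simp) (l, r) h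
  refine ⟨hconv, ⟨OrdCompletion.terminating_ordSys hgt,
    OrdCompletion.groundConfluent_ordSys hgt htotal hR hecp⟩, fun s t hs ht => ?_⟩
  rw [hconv]
  constructor
  · intro h
    have h' := OrdCompletion.conv_ordSys_subst hgt htotal hR (σ := fun _ => c.term)
      (fun _ => OrdCompletion.ground_constant c) h
    rwa [hs.subst_eq, ht.subst_eq] at h'
  · exact fun h => h.map (g := id) fun _ _ => OrdCompletion.Conv.of_ordSys_step
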